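/- A permutation $\sigma=\sigma(1)\cdots\sigma(n)$ of $[n]$ contains the pattern $\tau=\tau(1)\cdots\tau(k)$ if some subsequence of $\sigma$ has its entries in the same relative order as $\tau$; otherwise it avoids $\tau$. A permutation of $[n]$ with $n\ge 1$ is indecomposable if there is no $i$ with $1\le i<n$ such that $\sigma$ maps $\{1,\dots,i\}$ to itself; the empty permutation is not indecomposable. Let $a_n$ be the number of permutations of $[n]$ that avoid both $4321$ and $3241$, let $u_n$ be the number of the indecomposable ones among them, and put $F(x)=\sum_{n\ge 0}a_nx^n$ and $G(x)=\sum_{n\ge 0}u_nx^n$, as formal power series over $\mathbb{Q}$. Let $C_n=\frac{1}{n+1}\binom{2n}{n}$ be the Catalan numbers, $C(x)=\sum_{n\ge 0}C_nx^n=\frac{1-\sqrt{1-4x}}{2x}$, and let $C_{k,m}=\frac{m+1}{2k+m+1}\binom{2k+m+1}{k}$ for $k,m\ge 0$ be the ballot numbers. Then $$F(x)=\frac{1}{1-x\,C\big(x\,C(x)\big)},$$ and in particular $F$ is algebraic over $\mathbb{Q}[x]$. Moreover $$G(x)=x\,C\big(x\,C(x)\big),\qquad F(x)=\frac{1}{1-G(x)},$$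 and $u_0=0$, $u_1=1$, and for all $n\ge 2$ $$u_n=\sum_{k=0}^{n-2}C_{n-1-k}\,C_{k,\,n-2-k}=\sum_{k=0}^{n-2}\frac{n-1-k}{n-1+k}\binom{n-1+k}{k}\,C_{n-1-k}.$$ -/

import Mathlib

namespace PermPattern

/-- `σ` contains the classical pattern `τ`, a word given in one-line notation: some subsequence of
`σ(0), σ(1), …, σ(n-1)` is order-isomorphic to `τ`. -/
def Contains {n k : ℕ} (σ : Equiv.Perm (Fin n)) (τ : Fin k → ℕ) : Prop :=
  ∃ f : Fin k → Fin n, StrictMono f ∧ ∀ i j : Fin k, τ i < τ j ↔ σ (f i) < σ (f j)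

/-- `σ` avoids both classical patterns 4321 and 3241. -/
def IsAvoider {n : ℕ} (σ : Equiv.Perm (Fin n)) : Prop :=
  ¬ Contains σ ![4, 3, 2, 1] ∧ ¬ Contains σ ![3, 2, 4, 1]

/-- The places `0 < i < n` at which a bar can be inserted after the first `i` entries of `σ`, that
is, at which `σ` maps the first `i` positions to the `i` smallest values. -/
def bars {n : ℕ} (σ : Equiv.Perm (Fin n)) : Finset ℕ :=
  (Finset.Ioo 0 n).filter fun i => ∀ j : Fin n, (j : ℕ) < i → (σ j : ℕ) < i

/-- The number of components of `σ`; the empty permutation has none. -/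
def numComponents {n : ℕ} (σ : Equiv.Perm (Fin n)) : ℕ :=
  if n = 0 then 0 else (bars σ).card + 1

/-- A permutation is indecomposable if it has exactly one component. -/
def IsIndecomposable {n : ℕ} (σ : Equiv.Perm (Fin n)) : Prop :=
  numComponents σ = 1

/-- The number of permutations of length `n` that avoid 4321 and 3241. -/
noncomputable def numAvoiders (n : ℕ) : ℕ :=
  Nat.card {σ : Equiv.Perm (Fin n) // IsAvoider σ}

/-- The number of indecomposable permutations of length `n` that avoid 4321 and 3241. -/
noncomputable def numIndecAvoiders (n : ℕ) : ℕ :=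
  Nat.card {σ : Equiv.Perm (Fin n) // IsAvoider σ ∧ IsIndecomposable σ}

/-- The generating function of the permutations that avoid 4321 and 3241. -/
noncomputable def avoiderSeries : PowerSeries ℚ :=
  PowerSeries.mk fun n => (numAvoiders n : ℚ)

/-- The generating function of the indecomposable permutations that avoid 4321 and 3241. -/
noncomputable def indecAvoiderSeries : PowerSeries ℚ :=
  PowerSeries.mk fun n => (numIndecAvoiders n : ℚ)

/-- The generating function `C(x)` of the Catalan numbers. -/
noncomputable def catalanGF : PowerSeries ℚ :=
  PowerSeries.catalanSeries.map (Nat.castRingHom ℚ)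

/-- The closed form `C(x) = (1 - √(1 - 4x)) / (2x)`: the series `1 - 2 x C(x)`, whose constant term
is `1`, is the square root of `1 - 4x`. -/
theorem catalanGF_closed_form :
    (1 - 2 * (PowerSeries.X * catalanGF)) ^ 2 = (1 - 4 * PowerSeries.X : PowerSeries ℚ) := by
  have h : catalanGF ^ 2 * PowerSeries.X + 1 = catalanGF := by
    simpa [catalanGF] using congrArg (PowerSeries.map (Nat.castRingHom ℚ))
      PowerSeries.catalanSeries_sq_mul_X_add_one
  linear_combination (4 * PowerSeries.X) * h

/-- The composition below is defined. -/
theorem hasSubst_X_mul_catalanGF :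
    PowerSeries.HasSubst (PowerSeries.X * catalanGF : PowerSeries ℚ) :=
  PowerSeries.HasSubst.of_constantCoeff_zero' (by rw [map_mul]; simp)

/-- The series `x C(x C(x))`; the inner series `x C(x)` has zero constant term, so that the
composition of formal power series is defined. -/
noncomputable def xCxC : PowerSeries ℚ :=
  PowerSeries.X * PowerSeries.subst (PowerSeries.X * catalanGF : PowerSeries ℚ) catalanGF

/-- The ballot number `C_{n,m} = (m+1)/(2n+m+1) * binom(2n+m+1, n)`. -/
def ballot (n m : ℕ) : ℚ :=
  ((m : ℚ) + 1) / (2 * (n : ℚ) + (m : ℚ) + 1) * ((2 * n + m + 1).choose n : ℚ)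

end PermPattern

/-! In 4321 and 3241 the last letter is the smallest, and the three letters before it form a 321 or
a 213 (a block). So deleting the smallest letter of an avoider leaves an avoider, and a new smallest
letter may be inserted exactly where no complete block precedes it. The letters before the end of
the first block are an increasing run of length i followed by two increasing runs of lengths j and
k, the second below the first and both above the initial run. The triple (i, j, k) determines the
admissible places, and the place determines the next triple (`HasShape.avoids_insWord_iff`,
`HasShape.insWord`). This is a generating tree with three labels.

Its generating functions satisfy a linear system with a unique solution. Up to the factor x²C², that
solution is explicit in C, D = C(xC) and an auxiliary series μ (`shapeSolution_eq`); its value at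
(0, 0, 0) gives F = 1/(1 - xD).

Both patterns are sum-indecomposable, so splitting off the first component gives F = 1 + GF, whence
G = xD. The formula for u_n is the coefficient extraction in C(xC), the powers of C having ballot
numbers as coefficients (`coeff_catalanGF_pow`). -/

namespace PermPattern

/-! ### Words, blocks and insertion of a smallest letter -/

/-- The one-line notation of `σ`, extended by the identity beyond its length. -/
def word {n : ℕ} (σ : Equiv.Perm (Fin n)) (a : ℕ) : ℕ :=
  if h : a < n then σ ⟨a, h⟩ else a

/-- Insertion of a new smallest letter at place `p`. -/
def insWord (p : ℕ) (w : ℕ → ℕ) (a : ℕ) : ℕ :=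
  if a < p then w a + 1 else if a = p then 0 else w (a - 1) + 1

/-- The letters at `a < b < c` form one of the patterns 321 and 213. -/
def IsBlock (w : ℕ → ℕ) (a b c : ℕ) : Prop :=
  a < b ∧ b < c ∧ w b < w a ∧ (w c < w b ∨ w a < w c)

/-- The first `n` letters of `w` avoid 4321 and 3241. -/
def Avoids (n : ℕ) (w : ℕ → ℕ) : Prop :=
  ∀ a b c d, IsBlock w a b c → c < d → d < n → ¬ (w d < w b ∧ w d < w c)

theorem word_of_lt {n : ℕ} (σ : Equiv.Perm (Fin n)) {a : ℕ} (h : a < n) :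
    word σ a = σ ⟨a, h⟩ := dif_pos h

theorem word_val {n : ℕ} (σ : Equiv.Perm (Fin n)) (a : Fin n) : word σ a = σ a :=
  dif_pos a.2

theorem strictMono_vec4 {n : ℕ} {a b c d : Fin n} (h1 : a < b) (h2 : b < c) (h3 : c < d) :
    StrictMono ![a, b, c, d] := by
  rw [Fin.strictMono_iff_lt_succ]
  intro i
  fin_cases i <;> simpa

theorem isAvoider_iff {n : ℕ} (σ : Equiv.Perm (Fin n)) : IsAvoider σ ↔ Avoids n (word σ) := by
  constructor
  · rintro ⟨h1, h2⟩ a b c d ⟨hab, hbc, hba, hc⟩ hcd hd ⟨hdb, hdc⟩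
    rw [word_of_lt σ (by omega : a < n), word_of_lt σ (by omega : b < n)] at hba
    rw [word_of_lt σ (by omega : a < n), word_of_lt σ (by omega : b < n),
      word_of_lt σ (by omega : c < n)] at hc
    rw [word_of_lt σ (by omega : b < n), word_of_lt σ (by omega : d < n)] at hdb
    rw [word_of_lt σ (by omega : c < n), word_of_lt σ (by omega : d < n)] at hdc
    have hmono : StrictMono (![⟨a, by omega⟩, ⟨b, by omega⟩, ⟨c, by omega⟩, ⟨d, hd⟩] :
        Fin 4 → Fin n) := strictMono_vec4 hab hbc hcd
    rcases hc with hc | hc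
    · refine h1 ⟨_, hmono, fun i j => ?_⟩
      fin_cases i <;> fin_cases j <;> simp <;> omega
    · refine h2 ⟨_, hmono, fun i j => ?_⟩
      fin_cases i <;> fin_cases j <;> simp <;> omega
  · intro h
    constructor
    · rintro ⟨f, hf, hv⟩
      have e1 := (hv 1 0).1 (by simp)
      have e2 := (hv 2 1).1 (by simp)
      have e3 := (hv 3 2).1 (by simp)
      refine h (f 0) (f 1) (f 2) (f 3) ?_ (hf (by decide)) (f 3).2 ?_
      · simp only [IsBlock, word_val]
        exact ⟨hf (by decide), hf (by decide), e1, Or.inl e2⟩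
      · simp only [word_val]
        exact ⟨e3.trans e2, e3⟩
    · rintro ⟨f, hf, hv⟩
      have e1 := (hv 1 0).1 (by simp)
      have e2 := (hv 0 2).1 (by simp)
      have e3 := (hv 3 1).1 (by simp)
      refine h (f 0) (f 1) (f 2) (f 3) ?_ (hf (by decide)) (f 3).2 ?_
      · simp only [IsBlock, word_val]
        exact ⟨hf (by decide), hf (by decide), e1, Or.inr e2⟩
      · simp only [word_val]
        exact ⟨e3, e3.trans (e1.trans e2)⟩

/-- The permutation obtained from `σ` by inserting a new smallest value at position `p`. -/
def ins {n : ℕ} (p : Fin (n + 1)) (σ : Equiv.Perm (Fin n)) : Equiv.Perm (Fin (n + 1)) :=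
  (finSuccEquiv' p).trans ((Equiv.optionCongr σ).trans (finSuccEquiv' 0).symm)

theorem ins_self {n : ℕ} (p : Fin (n + 1)) (σ : Equiv.Perm (Fin n)) : ins p σ p = 0 := by
  simp [ins]

theorem ins_succAbove {n : ℕ} (p : Fin (n + 1)) (σ : Equiv.Perm (Fin n)) (a : Fin n) :
    ins p σ (p.succAbove a) = (σ a).succ := by
  simp [ins]

theorem ins_bijective (n : ℕ) :
    Function.Bijective fun x : Fin (n + 1) × Equiv.Perm (Fin n) => ins x.1 x.2 := by
  rw [Fintype.bijective_iff_injective_and_card]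
  constructor
  · rintro ⟨p, σ⟩ ⟨q, τ⟩ h
    simp only at h
    have hpq : p = q := by
      apply (ins p σ).injective
      rw [ins_self, h, ins_self]
    subst hpq
    refine Prod.ext rfl (Equiv.ext fun a => Fin.succ_injective _ ?_)
    rw [← ins_succAbove p σ, ← ins_succAbove p τ, h]
  · simp [Fintype.card_perm, Nat.factorial_succ]

/-- The identity tail of `word` makes this an equality of functions, with no bound on the position.
-/
theorem word_ins {n : ℕ} (p : Fin (n + 1)) (σ : Equiv.Perm (Fin n)) :
    word (ins p σ) = insWord p (word σ) := by
  funext a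
  have hp := p.2
  by_cases ha : a < n + 1
  · rw [word_of_lt _ ha]
    rcases lt_trichotomy a p with h | h | h
    · have : (⟨a, ha⟩ : Fin (n + 1)) = p.succAbove ⟨a, by omega⟩ := by
        rw [Fin.succAbove_of_castSucc_lt _ _ (by simpa [Fin.lt_def] using h)]; rfl
      rw [this, ins_succAbove, insWord, if_pos h, word_of_lt σ (by omega)]; rfl
    · have : (⟨a, ha⟩ : Fin (n + 1)) = p := Fin.ext h
      rw [this, ins_self, insWord, if_neg (by omega), if_pos h]; rfl
    · have : (⟨a, ha⟩ : Fin (n + 1)) = p.succAbove ⟨a - 1, by omega⟩ := by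
        rw [Fin.succAbove_of_le_castSucc _ _ (by simp [Fin.le_def]; omega)]
        ext; simp; omega
      rw [this, ins_succAbove, insWord, if_neg (by omega), if_neg (by omega),
        word_of_lt σ (by omega)]; rfl
  · rw [word, dif_neg ha, insWord, if_neg (by omega), if_neg (by omega), word, dif_neg (by omega)]
    omega

theorem insWord_of_lt {p a : ℕ} (w : ℕ → ℕ) (h : a < p) : insWord p w a = w a + 1 := if_pos h

theorem insWord_self (p : ℕ) (w : ℕ → ℕ) : insWord p w p = 0 := by simp [insWord]

theorem insWord_succ {p a : ℕ} (w : ℕ → ℕ) (h : p ≤ a) : insWord p w (a + 1) = w a + 1 := by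
  simp only [insWord]
  rw [if_neg (by omega), if_neg (by omega)]
  simp

/-- The position in the enlarged word of an old letter. -/
def shift (p a : ℕ) : ℕ := if a < p then a else a + 1

theorem insWord_shift (p a : ℕ) (w : ℕ → ℕ) : insWord p w (shift p a) = w a + 1 := by
  unfold shift
  split_ifs with h
  · exact insWord_of_lt w h
  · exact insWord_succ w (by omega)

theorem shift_lt_shift {p a b : ℕ} : shift p a < shift p b ↔ a < b := by
  unfold shift; split_ifs <;> omega

theorem exists_shift {p a : ℕ} (h : a ≠ p) : ∃ b, shift p b = a := by
  rcases lt_or_gt_of_ne h with h | h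
  · exact ⟨a, if_pos h⟩
  · exact ⟨a - 1, by unfold shift; split_ifs <;> omega⟩

theorem isBlock_shift {p a b c : ℕ} {w : ℕ → ℕ} :
    IsBlock (insWord p w) (shift p a) (shift p b) (shift p c) ↔ IsBlock w a b c := by
  simp only [IsBlock, insWord_shift, shift_lt_shift, Nat.add_lt_add_iff_right]

/-- The new letter is the smallest, so in an occurrence of a pattern it can only come last, after a
block of old letters. Blocks that run past n impose nothing, since p ≤ n. -/
theorem avoids_insWord {n p : ℕ} (hp : p ≤ n) (w : ℕ → ℕ) :
    Avoids (n + 1) (insWord p w) ↔ Avoids n w ∧ ∀ a b c, IsBlock w a b c → p ≤ c := by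
  constructor
  · refine fun h => ⟨fun a b c d hB hcd hd hlt => ?_, fun a b c hB => ?_⟩
    · refine h _ _ _ (shift p d) (isBlock_shift.2 hB) (shift_lt_shift.2 hcd) ?_ ?_
      · unfold shift; split_ifs <;> omega
      · simpa only [insWord_shift, Nat.add_lt_add_iff_right] using hlt
    · by_contra hc
      refine h _ _ _ p (isBlock_shift.2 hB) ?_ (by omega) ?_
      · unfold shift; split_ifs <;> omega
      · simp only [insWord_shift, insWord_self]; omega
  · rintro ⟨h, hB'⟩ a b c d hB hcd hd ⟨hdb, hdc⟩
    have hbp : b ≠ p := by rintro rfl; simp [insWord_self] at hdb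
    have hcp : c ≠ p := by rintro rfl; simp [insWord_self] at hdc
    have hap : a ≠ p := by rintro rfl; have := hB.2.2.1; simp [insWord_self] at this
    obtain ⟨a, rfl⟩ := exists_shift hap
    obtain ⟨b, rfl⟩ := exists_shift hbp
    obtain ⟨c, rfl⟩ := exists_shift hcp
    rw [isBlock_shift] at hB
    by_cases hdp : d = p
    · have := hB' a b c hB
      unfold shift at hcd
      split_ifs at hcd <;> omega
    · obtain ⟨d, rfl⟩ := exists_shift hdp
      rw [shift_lt_shift] at hcd
      simp only [insWord_shift, Nat.add_lt_add_iff_right] at hdb hdc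
      refine h a b c d hB hcd ?_ ⟨hdb, hdc⟩
      unfold shift at hd
      split_ifs at hd <;> omega

/-! ### Shapes and their evolution under insertion -/

/-- The word of length `n` starts with `i` letters in increasing order, followed by an increasing
run of `j` letters and by an increasing run of `k` letters that lie below those `j` and above
those `i`; the letter that follows, if any, completes a pattern 321 or 213. -/
structure HasShape (n : ℕ) (w : ℕ → ℕ) (i j k : ℕ) : Prop where
  le : i + j + k ≤ n
  incr_left : ∀ a b, a < b → b < i + j → w a < w b
  incr_right : ∀ a b, i + j ≤ a → a < b → b < i + j + k → w a < w b
  above : ∀ a b, a < i → i + j ≤ b → b < i + j + k → w a < w b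
  below : ∀ a b, i ≤ a → a < i + j → i + j ≤ b → b < i + j + k → w b < w a
  eq_of_zero : j = 0 ∨ k = 0 → i = n ∧ j = 0 ∧ k = 0
  block : i + j + k < n → ∃ a b, IsBlock w a b (i + j + k)

/-- A descent within the first i + j + k letters goes from the upper run to the lower one; any later
letter among them is then larger than the second letter and smaller than the first, which completes
neither 321 nor 213. -/
theorem HasShape.le_of_isBlock {n i j k : ℕ} {w : ℕ → ℕ} (h : HasShape n w i j k) {a b c : ℕ}
    (hB : IsBlock w a b c) : i + j + k ≤ c := by
  by_contra hc
  obtain ⟨hab, hbc, hba, hc'⟩ := hB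
  have hb : i + j ≤ b := by
    by_contra hb
    have := h.incr_left a b hab (by omega)
    omega
  have h1 := h.incr_right b c hb hbc (by omega)
  have ha : a < i + j := by
    by_contra ha
    have := h.incr_right a b (by omega) hab (by omega)
    omega
  have hi : i ≤ a := by
    by_contra hi
    have := h.above a b (by omega) hb (by omega)
    omega
  have := h.below a c hi ha (by omega) (by omega)
  omega

/-- The shape of the word after the insertion of a smallest letter at place `p`. -/
def stepShape (p i j k : ℕ) : ℕ × ℕ × ℕ :=
  if p = 0 then (i + 1, j, k)
  else if p ≤ i + j then (if i = 0 ∧ p = j then (0, j, k + 1) else (0, p, 1))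
  else (i, j, p - (i + j))

theorem HasShape.insWord_zero {n i j k : ℕ} {w : ℕ → ℕ} (h : HasShape n w i j k) :
    HasShape (n + 1) (insWord 0 w) (i + 1) j k where
  le := by have := h.le; omega
  incr_left a b hab hb := by
    obtain ⟨b, rfl⟩ : ∃ c, b = c + 1 := ⟨b - 1, by omega⟩
    rw [insWord_succ w (Nat.zero_le b)]
    rcases a with _ | a
    · rw [insWord_self]; omega
    · rw [insWord_succ w (Nat.zero_le a)]
      have := h.incr_left a b (by omega) (by omega)
      omega
  incr_right a b ha hab hb := by
    obtain ⟨a, rfl⟩ : ∃ c, a = c + 1 := ⟨a - 1, by omega⟩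
    obtain ⟨b, rfl⟩ : ∃ c, b = c + 1 := ⟨b - 1, by omega⟩
    rw [insWord_succ w (Nat.zero_le b), insWord_succ w (Nat.zero_le a)]
    have := h.incr_right a b (by omega) (by omega) (by omega)
    omega
  above a b ha hb hb' := by
    obtain ⟨b, rfl⟩ : ∃ c, b = c + 1 := ⟨b - 1, by omega⟩
    rw [insWord_succ w (Nat.zero_le b)]
    rcases a with _ | a
    · rw [insWord_self]; omega
    · rw [insWord_succ w (Nat.zero_le a)]
      have := h.above a b (by omega) (by omega) (by omega)
      omega
  below a b ha ha' hb hb' := by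
    obtain ⟨a, rfl⟩ : ∃ c, a = c + 1 := ⟨a - 1, by omega⟩
    obtain ⟨b, rfl⟩ : ∃ c, b = c + 1 := ⟨b - 1, by omega⟩
    rw [insWord_succ w (Nat.zero_le b), insWord_succ w (Nat.zero_le a)]
    have := h.below a b (by omega) (by omega) (by omega) (by omega)
    omega
  eq_of_zero hjk := by have := h.eq_of_zero hjk; omega
  block hlt := by
    obtain ⟨a, b, hB⟩ := h.block (by omega)
    refine ⟨shift 0 a, shift 0 b, ?_⟩
    have := isBlock_shift (p := 0).2 hB
    convert this using 1
    simp [shift]; omega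

theorem HasShape.insWord_right {n i j k p : ℕ} {w : ℕ → ℕ} (h : HasShape n w i j k)
    (hp : i + j < p) (hp' : p ≤ i + j + k) :
    HasShape (n + 1) (insWord p w) i j (p - (i + j)) where
  le := by have := h.le; omega
  incr_left a b hab hb := by
    rw [insWord_of_lt w (by omega), insWord_of_lt w (by omega)]
    have := h.incr_left a b hab hb
    omega
  incr_right a b ha hab hb := by
    rw [insWord_of_lt w (by omega), insWord_of_lt w (by omega)]
    have := h.incr_right a b ha hab (by omega)
    omega
  above a b ha hb hb' := by
    rw [insWord_of_lt w (by omega), insWord_of_lt w (by omega)]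
    have := h.above a b ha hb (by omega)
    omega
  below a b ha ha' hb hb' := by
    rw [insWord_of_lt w (by omega), insWord_of_lt w (by omega)]
    have := h.below a b ha ha' hb (by omega)
    omega
  eq_of_zero hjk := by
    have := h.eq_of_zero (Or.imp_right (by omega) hjk)
    omega
  block hlt := by
    have hj : j ≠ 0 := fun hj => by have := h.eq_of_zero (Or.inl hj); omega
    -- The last letter of the upper run, the first letter of the lower run and the new letter form a
    -- 321.
    refine ⟨i + j - 1, i + j, by omega, by omega, ?_, Or.inl ?_⟩
    · rw [insWord_of_lt w (by omega), insWord_of_lt w (by omega)]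
      have := h.below (i + j - 1) (i + j) (by omega) (by omega) le_rfl (by omega)
      omega
    · rw [show i + j + (p - (i + j)) = p by omega, insWord_self, insWord_of_lt w (by omega)]
      omega

theorem HasShape.insWord_between {n j k : ℕ} {w : ℕ → ℕ} (h : HasShape n w 0 j k) (hj : j ≠ 0) :
    HasShape (n + 1) (insWord j w) 0 j (k + 1) where
  le := by have := h.le; omega
  incr_left a b hab hb := by
    rw [insWord_of_lt w (by omega), insWord_of_lt w (by omega)]
    have := h.incr_left a b hab hb
    omega
  incr_right a b ha hab hb := by
    obtain ⟨b, rfl⟩ : ∃ c, b = c + 1 := ⟨b - 1, by omega⟩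
    rw [insWord_succ w (by omega)]
    rcases eq_or_lt_of_le ha with ha | ha
    · rw [← ha, zero_add, insWord_self]; omega
    · obtain ⟨a, rfl⟩ : ∃ c, a = c + 1 := ⟨a - 1, by omega⟩
      rw [insWord_succ w (by omega)]
      have := h.incr_right a b (by omega) (by omega) (by omega)
      omega
  above a b ha hb hb' := by omega
  below a b ha ha' hb hb' := by
    rw [insWord_of_lt w (by omega : a < j)]
    rcases eq_or_lt_of_le hb with hb | hb
    · rw [← hb, zero_add, insWord_self]; omega
    · obtain ⟨b, rfl⟩ : ∃ c, b = c + 1 := ⟨b - 1, by omega⟩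
      rw [insWord_succ w (by omega)]
      have := h.below a b ha ha' (by omega) (by omega)
      omega
  eq_of_zero hjk := by omega
  block hlt := by
    obtain ⟨a, b, hB⟩ := h.block (by omega)
    refine ⟨shift j a, shift j b, ?_⟩
    have := isBlock_shift (p := j).2 hB
    convert this using 1
    simp only [shift]; split_ifs <;> omega

theorem HasShape.insWord_left {n i j k p : ℕ} {w : ℕ → ℕ} (h : HasShape n w i j k)
    (hp : p ≠ 0) (hp' : p ≤ i + j) (hne : ¬ (i = 0 ∧ p = j)) :
    HasShape (n + 1) (insWord p w) 0 p 1 where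
  le := by have := h.le; omega
  incr_left a b hab hb := by
    rw [insWord_of_lt w (by omega), insWord_of_lt w (by omega)]
    have := h.incr_left a b hab (by omega)
    omega
  incr_right a b ha hab hb := by omega
  above a b ha hb hb' := by omega
  below a b ha ha' hb hb' := by
    obtain rfl : b = p := by omega
    rw [insWord_self, insWord_of_lt w (by omega)]
    omega
  eq_of_zero hjk := by omega
  block hlt := by
    -- The first letter, the new one and its right neighbour form a 213. The neighbour exceeds the
    -- first letter: either both lie in the same increasing stretch, or the neighbour starts the
    -- lower run and i > 0.
    refine ⟨0, p, by omega, by omega, ?_, Or.inr ?_⟩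
    · rw [insWord_self, insWord_of_lt w (by omega)]; omega
    · rw [insWord_of_lt w (by omega), zero_add, insWord_succ w le_rfl]
      rcases eq_or_lt_of_le hp' with he | hl
      · have hk : k ≠ 0 := fun hk => by have := h.eq_of_zero (Or.inr hk); omega
        have := h.above 0 p (by omega) (by omega) (by omega)
        omega
      · have := h.incr_left 0 p (by omega) hl
        omega

theorem HasShape.insWord {n i j k p : ℕ} {w : ℕ → ℕ} (h : HasShape n w i j k)
    (hp : p ≤ i + j + k) :
    HasShape (n + 1) (insWord p w) (stepShape p i j k).1 (stepShape p i j k).2.1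
      (stepShape p i j k).2.2 := by
  unfold stepShape
  split_ifs with h1 h2 h3
  · subst h1; exact h.insWord_zero
  · obtain ⟨rfl, rfl⟩ := h3
    exact h.insWord_between h1
  · exact h.insWord_left h1 h2 h3
  · exact h.insWord_right (by omega) hp

theorem HasShape.avoids_insWord_iff {n i j k p : ℕ} {w : ℕ → ℕ} (h : HasShape n w i j k)
    (hw : Avoids n w) (hp : p ≤ n) : Avoids (n + 1) (PermPattern.insWord p w) ↔ p ≤ i + j + k := by
  rw [avoids_insWord hp]
  constructor
  · rintro ⟨-, hB⟩
    by_contra hlt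
    obtain ⟨a, b, hab⟩ := h.block (by omega)
    have := hB _ _ _ hab
    omega
  · exact fun hle => ⟨hw, fun a b c hB => hle.trans (h.le_of_isBlock hB)⟩

/-! ### Counting by iterated insertion -/

/-- The number of ways to extend a permutation of shape `(i, j, k)` by `m` successive insertions
of a smallest value, avoiding 4321 and 3241. -/
def shapeCount : ℕ → ℕ → ℕ → ℕ → ℕ
  | 0, _, _, _ => 1
  | m + 1, i, j, k => ∑ p ∈ Finset.range (i + j + k + 1),
      shapeCount m (stepShape p i j k).1 (stepShape p i j k).2.1 (stepShape p i j k).2.2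

open Classical in
/-- The number of avoiders obtained from `σ` by `m` successive insertions of a smallest value. -/
noncomputable def extCount : (m : ℕ) → {n : ℕ} → Equiv.Perm (Fin n) → ℕ
  | 0, _, σ => if IsAvoider σ then 1 else 0
  | m + 1, _, σ => ∑ p, extCount m (ins p σ)

theorem IsAvoider.of_ins {n : ℕ} {p : Fin (n + 1)} {σ : Equiv.Perm (Fin n)}
    (h : IsAvoider (ins p σ)) : IsAvoider σ := by
  rw [isAvoider_iff, word_ins, avoids_insWord (Nat.le_of_lt_succ p.2)] at h
  exact (isAvoider_iff σ).2 h.1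

theorem extCount_of_not_isAvoider (m : ℕ) {n : ℕ} {σ : Equiv.Perm (Fin n)} (h : ¬ IsAvoider σ) :
    extCount m σ = 0 := by
  induction m generalizing n with
  | zero => exact if_neg h
  | succ m ih => exact Finset.sum_eq_zero fun p _ => ih fun hp => h hp.of_ins

theorem extCount_eq_shapeCount (m : ℕ) {n i j k : ℕ} {σ : Equiv.Perm (Fin n)} (h : IsAvoider σ)
    (hs : HasShape n (word σ) i j k) : extCount m σ = shapeCount m i j k := by
  induction m generalizing n i j k with
  | zero => exact if_pos h
  | succ m ih =>
    rw [extCount, shapeCount]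
    have hle := hs.le
    have hiff (p : Fin (n + 1)) : IsAvoider (ins p σ) ↔ (p : ℕ) ≤ i + j + k := by
      rw [isAvoider_iff, word_ins,
        hs.avoids_insWord_iff ((isAvoider_iff σ).1 h) (Nat.le_of_lt_succ p.2)]
    set g : ℕ → ℕ := fun p => if p ≤ i + j + k then
      shapeCount m (stepShape p i j k).1 (stepShape p i j k).2.1 (stepShape p i j k).2.2 else 0
      with hg
    have hsum : ∑ p : Fin (n + 1), extCount m (ins p σ) = ∑ p : Fin (n + 1), g p := by
      refine Finset.sum_congr rfl fun p _ => ?_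
      by_cases hp : (p : ℕ) ≤ i + j + k
      · rw [hg]
        simp only [if_pos hp]
        apply ih ((hiff p).2 hp)
        rw [word_ins]
        exact hs.insWord hp
      · rw [hg]
        simp only [if_neg hp]
        exact extCount_of_not_isAvoider m fun hav => hp ((hiff p).1 hav)
    rw [hsum, Fin.sum_univ_eq_sum_range g (n + 1),
      ← Finset.sum_subset (Finset.range_mono (by omega : i + j + k + 1 ≤ n + 1))]
    · refine Finset.sum_congr rfl fun p hp => if_pos ?_
      rw [Finset.mem_range] at hp; omega
    · intro p _ hp
      rw [Finset.mem_range] at hp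
      exact if_neg (by omega)

/-- By `ins_bijective`, each permutation of length n + m arises exactly once by m insertions. -/
theorem sum_extCount (m n : ℕ) :
    ∑ σ : Equiv.Perm (Fin n), extCount m σ = numAvoiders (n + m) := by
  classical
  induction m generalizing n with
  | zero =>
    simp only [extCount, numAvoiders]
    rw [Finset.sum_boole, Nat.card_eq_fintype_card, Fintype.card_subtype]
    rfl
  | succ m ih =>
    rw [show n + (m + 1) = n + 1 + m by omega, ← ih (n + 1),
      ← (Equiv.ofBijective _ (ins_bijective n)).sum_comp, Fintype.sum_prod_type, Finset.sum_comm]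
    rfl

theorem numAvoiders_eq_shapeCount (n : ℕ) : numAvoiders n = shapeCount n 0 0 0 := by
  have h := sum_extCount n 0
  rw [zero_add] at h
  rw [← h, Fintype.sum_unique]
  apply extCount_eq_shapeCount
  · rw [isAvoider_iff]
    intro a b c d _ _ hd
    omega
  · constructor <;> intros <;> omega


/-! ### The linear system for the generating functions -/

theorem sum_stepShape_of_pos {M : Type*} [AddCommMonoid M] (f : ℕ → ℕ → ℕ → M) {i j k : ℕ}
    (h : ¬ (i = 0 ∧ j ≠ 0)) :
    ∑ p ∈ Finset.range (i + j + k + 1),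
        f (stepShape p i j k).1 (stepShape p i j k).2.1 (stepShape p i j k).2.2 =
      f (i + 1) j k + ∑ p ∈ Finset.range (i + j), f 0 (p + 1) 1 +
        ∑ q ∈ Finset.range k, f i j (q + 1) := by
  rw [Finset.sum_range_succ', Finset.sum_range_add, add_comm, ← add_assoc]
  congr 1
  · congr 1
    refine Finset.sum_congr rfl fun p hp => ?_
    rw [Finset.mem_range] at hp
    rw [stepShape, if_neg (by omega), if_pos (by omega), if_neg (by omega)]
  · refine Finset.sum_congr rfl fun q hq => ?_
    rw [stepShape, if_neg (by omega), if_neg (by omega),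
      show i + j + q + 1 - (i + j) = q + 1 by omega]

/-- With no initial run, insertion between the two runs lengthens the lower one to k + 1. This adds
the term q = k to those that come from insertions after the upper run. -/
theorem sum_stepShape_zero {M : Type*} [AddCommMonoid M] (f : ℕ → ℕ → ℕ → M) (j k : ℕ) :
    ∑ p ∈ Finset.range (0 + (j + 1) + k + 1),
        f (stepShape p 0 (j + 1) k).1 (stepShape p 0 (j + 1) k).2.1
          (stepShape p 0 (j + 1) k).2.2 =
      f 1 (j + 1) k + ∑ p ∈ Finset.range j, f 0 (p + 1) 1 +
        ∑ q ∈ Finset.range (k + 1), f 0 (j + 1) (q + 1) := by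
  have h1 : ∀ p ∈ Finset.range j, f (stepShape (p + 1) 0 (j + 1) k).1
      (stepShape (p + 1) 0 (j + 1) k).2.1 (stepShape (p + 1) 0 (j + 1) k).2.2 =
      f 0 (p + 1) 1 := fun p hp => by
    rw [Finset.mem_range] at hp
    rw [stepShape, if_neg (by omega), if_pos (by omega), if_neg (by omega)]
  have h2 : ∀ q ∈ Finset.range k, f (stepShape (j + 1 + q + 1) 0 (j + 1) k).1
      (stepShape (j + 1 + q + 1) 0 (j + 1) k).2.1 (stepShape (j + 1 + q + 1) 0 (j + 1) k).2.2 =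
      f 0 (j + 1) (q + 1) := fun q hq => by
    rw [stepShape, if_neg (by omega), if_neg (by omega),
      show j + 1 + q + 1 - (0 + (j + 1)) = q + 1 by omega]
  have h3 : stepShape (j + 1) 0 (j + 1) k = (0, j + 1, k + 1) := by simp [stepShape]
  have h4 : stepShape 0 0 (j + 1) k = (1, j + 1, k) := by simp [stepShape]
  rw [Finset.sum_range_succ', Finset.sum_range_add, zero_add, Finset.sum_range_succ (n := j),
    Finset.sum_range_succ (n := k), Finset.sum_congr rfl h1, Finset.sum_congr rfl h2, h3, h4]
  abel

theorem stepShape_eq_zero_iff {p i j k : ℕ} (h : j = 0 ↔ k = 0) (hp : p ≤ i + j + k) :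
    (stepShape p i j k).2.1 = 0 ↔ (stepShape p i j k).2.2 = 0 := by
  unfold stepShape
  split_ifs <;> simp <;> omega

open PowerSeries

/-- The generating function of the numbers `shapeCount m i j k`. -/
noncomputable def shapeSeries (i j k : ℕ) : PowerSeries ℚ :=
  PowerSeries.mk fun m => (shapeCount m i j k : ℚ)

theorem shapeSeries_eq (i j k : ℕ) :
    shapeSeries i j k = 1 + X * ∑ p ∈ Finset.range (i + j + k + 1),
      shapeSeries (stepShape p i j k).1 (stepShape p i j k).2.1 (stepShape p i j k).2.2 := by
  ext m
  rcases m with _ | m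
  · simp [shapeSeries, shapeCount]
  · rw [map_add, coeff_succ_X_mul, map_sum, coeff_one, if_neg (by omega), zero_add]
    simp [shapeSeries, shapeCount]

/-- The recursion for the series `shapeSeries` determines them up to a common factor. -/
theorem eq_mul_shapeSeries (K : PowerSeries ℚ) (Y : ℕ → ℕ → ℕ → PowerSeries ℚ)
    (hY : ∀ i j k, (j = 0 ↔ k = 0) → Y i j k = K + X * ∑ p ∈ Finset.range (i + j + k + 1),
      Y (stepShape p i j k).1 (stepShape p i j k).2.1 (stepShape p i j k).2.2)
    (i j k : ℕ) (h : j = 0 ↔ k = 0) : Y i j k = K * shapeSeries i j k := by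
  ext m
  induction m generalizing i j k with
  | zero => rw [hY i j k h, shapeSeries_eq]; simp
  -- The factor X makes coefficient m + 1 depend only on coefficients of index m.
  | succ m ih =>
    rw [hY i j k h, shapeSeries_eq, mul_add, mul_one, mul_left_comm, map_add, map_add,
      coeff_succ_X_mul, coeff_succ_X_mul, Finset.mul_sum, map_sum, map_sum]
    congr 1
    refine Finset.sum_congr rfl fun p hp => ih _ _ _ (stepShape_eq_zero_iff h ?_)
    rw [Finset.mem_range] at hp
    omega

/-! ### Explicit solution of the system -/

section Solution

variable {R : Type*} [CommRing R]

/-- The closed form of the generating functions `shapeSeries i j k`, up to a common factor. -/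
def shapeSolution (x C D J μ : R) (i j k : ℕ) : R :=
  if i = 0 ∧ j ≠ 0 then D ^ (j - 1) * (μ ^ (k - 1) - (1 - x * C * D) * C ^ k)
  else x ^ 2 * C ^ 2 * J * D ^ (i + j) * μ ^ k

variable {x C D J μ : R}

theorem shapeSolution_zero_succ (j k : ℕ) : shapeSolution x C D J μ 0 (j + 1) (k + 1) =
    D ^ j * (μ ^ k - (1 - x * C * D) * C ^ (k + 1)) := by
  simp [shapeSolution]

/-- Since 1 - (1 - xCD)C = xC²(D - 1), the summand is xC²D^p(D - 1) and the sum telescopes. -/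
theorem mul_sum_shapeSolution (hC : C = 1 + x * C ^ 2) (r : ℕ) :
    x * ∑ p ∈ Finset.range r, shapeSolution x C D J μ 0 (p + 1) 1 =
      x ^ 2 * C ^ 2 * (D ^ r - 1) := by
  induction r with
  | zero => simp
  | succ r ih =>
    rw [Finset.sum_range_succ, mul_add, ih, shapeSolution_zero_succ, pow_succ D r]
    linear_combination (-x * D ^ r) * hC

theorem mul_sum_pow_mu (hμ : μ * (1 - x - x * D) = 1 - x * D) (k : ℕ) :
    x * ∑ q ∈ Finset.range k, μ ^ (q + 1) = (1 - x * D) * (μ ^ k - 1) := by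
  induction k with
  | zero => simp
  | succ k ih =>
    rw [Finset.sum_range_succ, mul_add, ih, pow_succ]
    linear_combination (-μ ^ k) * hμ

theorem mul_sum_pow_catalan (hC : C = 1 + x * C ^ 2) (k : ℕ) :
    x * ∑ q ∈ Finset.range (k + 1), C ^ (q + 1) = C ^ k - 1 + x * C := by
  induction k with
  | zero => simp
  | succ k ih =>
    rw [Finset.sum_range_succ, mul_add, ih]
    linear_combination (-C ^ k) * hC

/-- Summation over the lower run reproduces powers of C, or of μ, up to constants. For i = 0 < j the
weight 1 - xCD makes those constants cancel, and insertion at place 0 couples the equation to the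
shapes with i > 0, which brings in μ. -/
theorem shapeSolution_eq (hC : C = 1 + x * C ^ 2) (hD : D = 1 + x * C * D ^ 2)
    (hJ : J * (1 - x * D) = 1) (hμ : μ * (1 - x - x * D) = 1 - x * D)
    {i j k : ℕ} (h : j = 0 ↔ k = 0) :
    shapeSolution x C D J μ i j k = x ^ 2 * C ^ 2 + x * ∑ p ∈ Finset.range (i + j + k + 1),
      shapeSolution x C D J μ (stepShape p i j k).1 (stepShape p i j k).2.1
        (stepShape p i j k).2.2 := by
  by_cases hij : i = 0 ∧ j ≠ 0
  · obtain ⟨rfl, hj⟩ := hij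
    obtain ⟨j, rfl⟩ := Nat.exists_eq_succ_of_ne_zero hj
    obtain ⟨k, rfl⟩ := Nat.exists_eq_succ_of_ne_zero (mt h.2 hj)
    -- This is the comparison of the coefficients of D^j μ^k: the term with J comes from insertion
    -- at place 0, and 1 - xD from the geometric sum.
    have hM : μ * (x ^ 3 * C ^ 2 * D ^ 2 * J + 1 - x * D) = 1 := by
      have h1 : x ^ 3 * C ^ 2 * D ^ 2 + (1 - x * D) ^ 2 = 1 - x - x * D := by
        linear_combination (-x ^ 2 * D ^ 2) * hC - x * hD
      linear_combination (μ * J) * h1 + J * hμ + (1 - μ * (1 - x * D)) * hJ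
    simp only [Nat.succ_eq_add_one]
    rw [sum_stepShape_zero, mul_add, mul_add, mul_sum_shapeSolution hC]
    simp only [shapeSolution_zero_succ]
    rw [← Finset.mul_sum, Finset.sum_sub_distrib, ← Finset.mul_sum, Finset.sum_range_succ',
      mul_left_comm x (D ^ j), mul_sub x, mul_add x, mul_sum_pow_mu hμ,
      mul_left_comm x (1 - x * C * D), mul_sum_pow_catalan hC, shapeSolution, if_neg (by omega),
      pow_succ μ k, show 1 + (j + 1) = j + 2 by omega]
    linear_combination (-D ^ j * μ ^ k) * hM + (x * D ^ j * (D + 1)) * hC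
  · rw [sum_stepShape_of_pos _ hij, mul_add, mul_add, mul_sum_shapeSolution hC]
    have hr : ∀ q, shapeSolution x C D J μ i j q = x ^ 2 * C ^ 2 * J * D ^ (i + j) * μ ^ q :=
      fun q => by rw [shapeSolution, if_neg hij]
    simp only [hr]
    rw [← Finset.mul_sum, mul_left_comm x, mul_sum_pow_mu hμ, shapeSolution, if_neg (by omega),
      show i + 1 + j = i + j + 1 by omega]
    linear_combination (x ^ 2 * C ^ 2 * D ^ (i + j)) * hJ

end Solution

/-! ### Specialization to the Catalan series -/

theorem catalanGF_eq : catalanGF = 1 + X * catalanGF ^ 2 := by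
  have h := congrArg (PowerSeries.map (Nat.castRingHom ℚ)) catalanSeries_sq_mul_X_add_one
  rw [map_add, map_mul, map_pow, map_one, PowerSeries.map_X] at h
  change catalanGF ^ 2 * X + 1 = catalanGF at h
  linear_combination -h

/-- The series `C(x C(x))`. -/
noncomputable def catalanComp : PowerSeries ℚ :=
  PowerSeries.subst (X * catalanGF : PowerSeries ℚ) catalanGF

theorem xCxC_eq : xCxC = X * catalanComp := rfl

theorem catalanComp_eq : catalanComp = 1 + X * catalanGF * catalanComp ^ 2 := by
  have h := congrArg (substAlgHom (R := ℚ) hasSubst_X_mul_catalanGF) catalanGF_eq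
  rw [map_add, map_mul, map_pow, map_one, substAlgHom_X] at h
  simp only [coe_substAlgHom] at h
  exact h

theorem catalanGF_ne_zero : catalanGF ≠ 0 := by
  intro h
  have := catalanGF_eq
  simp [h] at this

theorem avoiderSeries_eq : avoiderSeries = (1 - xCxC)⁻¹ := by
  have hJ : (1 - X * catalanComp)⁻¹ * (1 - X * catalanComp) = 1 :=
    PowerSeries.inv_mul_cancel _ (by simp)
  have hμ : (1 - X * catalanComp) * (1 - X - X * catalanComp)⁻¹ * (1 - X - X * catalanComp) =
      1 - X * catalanComp := by
    rw [mul_assoc, PowerSeries.inv_mul_cancel _ (by simp), mul_one]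
  have h := eq_mul_shapeSeries (X ^ 2 * catalanGF ^ 2)
    (shapeSolution X catalanGF catalanComp _ _)
    (fun i j k => shapeSolution_eq catalanGF_eq catalanComp_eq hJ hμ) 0 0 0 Iff.rfl
  have h0 : avoiderSeries = shapeSeries 0 0 0 := by
    ext n
    simp [avoiderSeries, shapeSeries, numAvoiders_eq_shapeCount]
  rw [h0, xCxC_eq]
  -- At (0, 0, 0) the solution is x²C²J, and the common factor x²C² is nonzero.
  refine (mul_left_cancel₀ (mul_ne_zero (pow_ne_zero 2 X_ne_zero)
    (pow_ne_zero 2 catalanGF_ne_zero)) (h.symm.trans ?_))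
  simp [shapeSolution]


/-! ### Direct sums and the first component -/

/-- The direct sum of two permutations. -/
def directSum {k m : ℕ} (α : Equiv.Perm (Fin k)) (β : Equiv.Perm (Fin m)) :
    Equiv.Perm (Fin (k + m)) :=
  finSumFinEquiv.permCongr (Equiv.Perm.sumCongr α β)

theorem directSum_castAdd {k m : ℕ} (α : Equiv.Perm (Fin k)) (β : Equiv.Perm (Fin m)) (a : Fin k) :
    directSum α β (Fin.castAdd m a) = Fin.castAdd m (α a) := by
  simp [directSum, Equiv.permCongr_apply]

theorem directSum_natAdd {k m : ℕ} (α : Equiv.Perm (Fin k)) (β : Equiv.Perm (Fin m)) (b : Fin m) :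
    directSum α β (Fin.natAdd k b) = Fin.natAdd k (β b) := by
  simp [directSum, Equiv.permCongr_apply]

theorem directSum_injective {k m : ℕ} {α α' : Equiv.Perm (Fin k)} {β β' : Equiv.Perm (Fin m)}
    (h : directSum α β = directSum α' β') : α = α' ∧ β = β' := by
  constructor
  · ext a
    have := congrArg (fun σ : Equiv.Perm (Fin (k + m)) => (σ (Fin.castAdd m a) : ℕ)) h
    simpa [directSum_castAdd] using this
  · ext b
    have := congrArg (fun σ : Equiv.Perm (Fin (k + m)) => (σ (Fin.natAdd k b) : ℕ)) h
    simpa [directSum_natAdd] using this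

/-- `σ` maps the first `k` positions to the `k` smallest values. -/
def FixesInit {n : ℕ} (σ : Equiv.Perm (Fin n)) (k : ℕ) : Prop :=
  ∀ a : Fin n, (a : ℕ) < k → (σ a : ℕ) < k

theorem exists_directSum {k m : ℕ} {σ : Equiv.Perm (Fin (k + m))} (h : FixesInit σ k) :
    ∃ α β, directSum α β = σ := by
  have hm : Set.MapsTo (finSumFinEquiv.symm.permCongr σ) (Set.range (Sum.inl : Fin k → Fin k ⊕ Fin m))
      (Set.range Sum.inl) := by
    rintro _ ⟨a, rfl⟩
    have ha := h (Fin.castAdd m a) a.2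
    refine ⟨⟨σ (Fin.castAdd m a), ha⟩, finSumFinEquiv.injective ?_⟩
    ext
    simp [Equiv.permCongr_apply]
  obtain ⟨⟨α, β⟩, hαβ⟩ := Equiv.Perm.mem_sumCongrHom_range_of_perm_mapsTo_inl hm
  refine ⟨α, β, ?_⟩
  rw [Equiv.Perm.sumCongrHom_apply] at hαβ
  rw [directSum, hαβ]
  ext
  simp [Equiv.permCongr_apply]

theorem word_directSum_left {k m a : ℕ} (α : Equiv.Perm (Fin k)) (β : Equiv.Perm (Fin m))
    (h : a < k) : word (directSum α β) a = word α a := by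
  rw [word_of_lt _ (by omega : a < k + m), word_of_lt _ h,
    show (⟨a, by omega⟩ : Fin (k + m)) = Fin.castAdd m ⟨a, h⟩ from rfl, directSum_castAdd]
  rfl

theorem word_directSum_right {k m : ℕ} (α : Equiv.Perm (Fin k)) (β : Equiv.Perm (Fin m))
    (a : ℕ) : word (directSum α β) (k + a) = k + word β a := by
  by_cases h : a < m
  · rw [word_of_lt _ (by omega : k + a < k + m), word_of_lt _ h,
      show (⟨k + a, by omega⟩ : Fin (k + m)) = Fin.natAdd k ⟨a, h⟩ from rfl, directSum_natAdd]
    rfl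
  · rw [word, dif_neg (by omega), word, dif_neg h]

theorem word_lt {n a : ℕ} (σ : Equiv.Perm (Fin n)) (h : a < n) : word σ a < n := by
  rw [word_of_lt σ h]; exact (σ _).2

/-- If an occurrence starts in the left summand, its second and fourth letters are smaller than its
first, so they lie there too, and with them the third. -/
theorem isAvoider_directSum {k m : ℕ} (α : Equiv.Perm (Fin k)) (β : Equiv.Perm (Fin m)) :
    IsAvoider (directSum α β) ↔ IsAvoider α ∧ IsAvoider β := by
  simp only [isAvoider_iff]
  have hl : ∀ a, a < k → word (directSum α β) a < k := fun a ha => by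
    rw [word_directSum_left α β ha]; exact word_lt α ha
  have hr : ∀ a, k ≤ a → k ≤ word (directSum α β) a := fun a ha => by
    obtain ⟨b, rfl⟩ := Nat.exists_eq_add_of_le ha
    rw [word_directSum_right]; omega
  constructor
  · refine fun h => ⟨fun a b c d hB hcd hd => ?_, fun a b c d hB hcd hd => ?_⟩
    · have := h a b c d
      obtain ⟨hab, hbc, hB⟩ := hB
      simp only [IsBlock, word_directSum_left α β (by omega : a < k),
        word_directSum_left α β (by omega : b < k), word_directSum_left α β (by omega : c < k),
        word_directSum_left α β hd] at this
      exact this ⟨hab, hbc, hB⟩ hcd (by omega)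
    · have := h (k + a) (k + b) (k + c) (k + d)
      simp only [IsBlock, word_directSum_right, Nat.add_lt_add_iff_left] at this
      exact this hB hcd hd
  · rintro ⟨hα, hβ⟩ a b c d ⟨hab, hbc, hba, hc⟩ hcd hd ⟨hdb, hdc⟩
    by_cases ha : a < k
    · have h1 := hl a ha
      have hb : b < k := by
        by_contra hb
        have := hr b (by omega)
        omega
      have h2 := hl b hb
      have hdk : d < k := by
        by_contra hdk
        have := hr d (by omega)
        omega
      rw [word_directSum_left α β ha, word_directSum_left α β hb] at hba
      rw [word_directSum_left α β ha, word_directSum_left α β hb,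
        word_directSum_left α β (by omega : c < k)] at hc
      rw [word_directSum_left α β hdk, word_directSum_left α β hb] at hdb
      rw [word_directSum_left α β hdk, word_directSum_left α β (by omega : c < k)] at hdc
      exact hα a b c d ⟨hab, hbc, hba, hc⟩ hcd hdk ⟨hdb, hdc⟩
    · obtain ⟨a, rfl⟩ := Nat.exists_eq_add_of_le (by omega : k ≤ a)
      obtain ⟨b, rfl⟩ := Nat.exists_eq_add_of_le (by omega : k ≤ b)
      obtain ⟨c, rfl⟩ := Nat.exists_eq_add_of_le (by omega : k ≤ c)
      obtain ⟨d, rfl⟩ := Nat.exists_eq_add_of_le (by omega : k ≤ d)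
      simp only [word_directSum_right, Nat.add_lt_add_iff_left] at hab hbc hba hc hcd hd hdb hdc
      exact hβ a b c d ⟨hab, hbc, hba, hc⟩ hcd hd ⟨hdb, hdc⟩

theorem fixesInit_directSum {k m l : ℕ} (hl : l ≤ k) (α : Equiv.Perm (Fin k))
    (β : Equiv.Perm (Fin m)) : FixesInit (directSum α β) l ↔ FixesInit α l := by
  constructor
  · intro h a ha
    simpa [directSum_castAdd] using h (Fin.castAdd m a) ha
  · intro h a ha
    have := h ⟨a, by omega⟩ ha
    rw [show a = Fin.castAdd m ⟨a, by omega⟩ from rfl, directSum_castAdd]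
    exact this

theorem isIndecomposable_iff {n : ℕ} (σ : Equiv.Perm (Fin n)) :
    IsIndecomposable σ ↔ 0 < n ∧ ∀ l, 0 < l → l < n → ¬ FixesInit σ l := by
  unfold IsIndecomposable numComponents
  split_ifs with h
  · exact iff_of_false not_false (fun H => H.1.ne' h)
  · rw [Nat.add_eq_right, Finset.card_eq_zero, bars, Finset.filter_eq_empty_iff]
    simp only [Finset.mem_Ioo, and_imp]
    exact ⟨fun H => ⟨by omega, H⟩, fun H => H.2⟩

/-- `k` is the length of the first component of `σ`. -/
def IsFirstLength {n : ℕ} (σ : Equiv.Perm (Fin n)) (k : ℕ) : Prop :=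
  0 < k ∧ FixesInit σ k ∧ ∀ l, 0 < l → l < k → ¬ FixesInit σ l

theorem existsUnique_isFirstLength {n : ℕ} (hn : 0 < n) (σ : Equiv.Perm (Fin n)) :
    ∃ k, k ≤ n ∧ IsFirstLength σ k ∧ ∀ l, IsFirstLength σ l → l = k := by
  classical
  have hex : ∃ k, 0 < k ∧ FixesInit σ k := ⟨n, hn, fun a _ => (σ a).2⟩
  have hk : IsFirstLength σ (Nat.find hex) := by
    refine ⟨(Nat.find_spec hex).1, (Nat.find_spec hex).2, fun l hl hlt hf => ?_⟩
    exact Nat.find_min hex hlt ⟨hl, hf⟩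
  refine ⟨Nat.find hex, Nat.find_min' hex ⟨hn, fun a _ => (σ a).2⟩, hk, fun l hl => ?_⟩
  rcases lt_trichotomy l (Nat.find hex) with h | h | h
  · exact absurd hl.2.1 (hk.2.2 l hl.1 h)
  · exact h
  · exact absurd hk.2.1 (hl.2.2 _ hk.1 h)

theorem isFirstLength_directSum {k m : ℕ} (hk : 0 < k) (α : Equiv.Perm (Fin k))
    (β : Equiv.Perm (Fin m)) : IsFirstLength (directSum α β) k ↔ IsIndecomposable α := by
  rw [isIndecomposable_iff]
  constructor
  · rintro ⟨-, -, h⟩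
    exact ⟨hk, fun l hl hlt hf => h l hl hlt ((fixesInit_directSum hlt.le α β).2 hf)⟩
  · rintro ⟨-, h⟩
    exact ⟨hk, (fixesInit_directSum le_rfl α β).2 fun a _ => (α a).2,
      fun l hl hlt hf => h l hl hlt ((fixesInit_directSum hlt.le α β).1 hf)⟩

theorem card_avoider_isFirstLength {k m : ℕ} (hk : 0 < k) :
    Nat.card {σ : Equiv.Perm (Fin (k + m)) // IsAvoider σ ∧ IsFirstLength σ k} =
      numIndecAvoiders k * numAvoiders m := by
  rw [numIndecAvoiders, numAvoiders, ← Nat.card_prod]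
  refine (Nat.card_congr (Equiv.ofBijective (fun x => ⟨directSum x.1.1 x.2.1,
    (isAvoider_directSum _ _).2 ⟨x.1.2.1, x.2.2⟩,
    (isFirstLength_directSum hk _ _).2 x.1.2.2⟩) ⟨?_, ?_⟩)).symm
  · rintro ⟨⟨α, hα⟩, ⟨β, hβ⟩⟩ ⟨⟨α', hα'⟩, ⟨β', hβ'⟩⟩ h
    obtain ⟨rfl, rfl⟩ := directSum_injective (Subtype.ext_iff.1 h)
    rfl
  · rintro ⟨σ, hav, hfl⟩
    obtain ⟨α, β, rfl⟩ := exists_directSum hfl.2.1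
    have hav' := (isAvoider_directSum α β).1 hav
    exact ⟨⟨⟨α, hav'.1, (isFirstLength_directSum hk α β).1 hfl⟩, ⟨β, hav'.2⟩⟩, rfl⟩

theorem numAvoiders_succ (n : ℕ) :
    numAvoiders (n + 1) =
      ∑ k ∈ Finset.range (n + 1), numIndecAvoiders (k + 1) * numAvoiders (n - k) := by
  classical
  have hcard (k : ℕ) (hk : k ∈ Finset.range (n + 1)) :
      numIndecAvoiders (k + 1) * numAvoiders (n - k) =
        ((Finset.univ.filter fun σ : Equiv.Perm (Fin (n + 1)) => IsAvoider σ).filter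
          fun σ => IsFirstLength σ (k + 1)).card := by
    rw [Finset.mem_range] at hk
    obtain ⟨m, rfl⟩ := Nat.exists_eq_add_of_le (by omega : k ≤ n)
    rw [Nat.add_sub_cancel_left, ← card_avoider_isFirstLength (Nat.succ_pos k),
      Finset.filter_filter, show k + 1 + m = k + m + 1 by omega, Nat.card_eq_fintype_card,
      Fintype.card_subtype]
  rw [Finset.sum_congr rfl hcard, numAvoiders, Nat.card_eq_fintype_card, Fintype.card_subtype]
  choose f hf using fun σ : Equiv.Perm (Fin (n + 1)) =>
    existsUnique_isFirstLength (Nat.succ_pos n) σ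
  -- First lengths lie between 1 and n + 1, hence the shift by one.
  rw [Finset.card_eq_sum_card_fiberwise (f := fun σ => f σ - 1) (t := Finset.range (n + 1))]
  · refine Finset.sum_congr rfl fun k _ => congrArg Finset.card (Finset.filter_congr fun σ _ => ?_)
    obtain ⟨-, h1, h2⟩ := hf σ
    constructor
    · intro h
      have := h1.1
      rwa [show k + 1 = f σ by omega]
    · intro h
      rw [← h2 _ h]
      rfl
  · intro σ _
    have := (hf σ).1
    have := (hf σ).2.1.1
    simp
    omega

theorem numIndecAvoiders_zero : numIndecAvoiders 0 = 0 := by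
  have : IsEmpty {σ : Equiv.Perm (Fin 0) // IsAvoider σ ∧ IsIndecomposable σ} :=
    ⟨fun σ => absurd ((isIndecomposable_iff σ.1).1 σ.2.2).1 (lt_irrefl 0)⟩
  exact Nat.card_of_isEmpty

theorem avoiderSeries_eq_one_add :
    avoiderSeries = 1 + indecAvoiderSeries * avoiderSeries := by
  ext n
  rcases n with _ | n
  · simp [avoiderSeries, indecAvoiderSeries, numIndecAvoiders_zero, numAvoiders_eq_shapeCount,
      shapeCount]
  · rw [map_add, PowerSeries.coeff_one, if_neg (by omega), zero_add, PowerSeries.coeff_mul,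
      Finset.Nat.sum_antidiagonal_succ]
    simp only [avoiderSeries, indecAvoiderSeries, PowerSeries.coeff_mk, numIndecAvoiders_zero,
      Nat.cast_zero, zero_mul, zero_add]
    rw [numAvoiders_succ, Finset.Nat.sum_antidiagonal_eq_sum_range_succ
      (fun k m => (numIndecAvoiders (k + 1) : ℚ) * (numAvoiders m : ℚ))]
    push_cast
    rfl

theorem avoiderSeries_mul_one_sub : avoiderSeries * (1 - PowerSeries.X * catalanComp) = 1 := by
  rw [avoiderSeries_eq, xCxC_eq]
  exact PowerSeries.inv_mul_cancel _ (by simp)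

/-- Both series solve F(1 - Z) = 1, and F ≠ 0. -/
theorem indecAvoiderSeries_eq : indecAvoiderSeries = xCxC := by
  have h := avoiderSeries_mul_one_sub
  have h0 : avoiderSeries ≠ 0 := by
    intro h0
    simp [h0] at h
  refine mul_right_cancel₀ h0 ?_
  rw [xCxC_eq]
  linear_combination h - avoiderSeries_eq_one_add


/-! ### Algebraicity -/

theorem isAlgebraic_avoiderSeries : IsAlgebraic (Polynomial ℚ) avoiderSeries := by
  let x : Polynomial (Polynomial ℚ) := Polynomial.C Polynomial.X
  let y : Polynomial (Polynomial ℚ) := Polynomial.X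
  -- Elimination of C and D: at y = F one has y - 1 = xDy and y - 1 - xy = x²CD²y, and the
  -- polynomial becomes x⁴D⁴y⁴(xC² - C + 1) = 0.
  refine ⟨x * y ^ 2 * (y - 1 - x * y) ^ 2 - (y - 1 - x * y) * (y - 1) ^ 2 * y + (y - 1) ^ 4,
    fun h => ?_, ?_⟩
  · have := congrArg (Polynomial.eval 0) h
    simp [x, y] at this
  · have hx : Polynomial.aeval avoiderSeries x = PowerSeries.X := by
      simp [x, PowerSeries.algebraMap_apply']
    have hy : Polynomial.aeval avoiderSeries y = avoiderSeries := Polynomial.aeval_X _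
    simp only [map_add, map_sub, map_mul, map_pow, map_one, hx, hy]
    have h1 : avoiderSeries - 1 = PowerSeries.X * catalanComp * avoiderSeries := by
      linear_combination avoiderSeries_mul_one_sub
    have h2 : avoiderSeries - 1 - PowerSeries.X * avoiderSeries =
        PowerSeries.X ^ 2 * catalanGF * catalanComp ^ 2 * avoiderSeries := by
      linear_combination h1 + PowerSeries.X * avoiderSeries * catalanComp_eq
    rw [h2, h1]
    linear_combination (-PowerSeries.X ^ 4 * catalanComp ^ 4 * avoiderSeries ^ 4) * catalanGF_eq

/-! ### Ballot numbers and coefficient extraction -/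

theorem ballot_zero (m : ℕ) : ballot 0 m = 1 := by
  have : (m : ℚ) + 1 ≠ 0 := by positivity
  simp [ballot, this]

theorem ballot_eq (k m : ℕ) :
    ballot k m = ((m : ℚ) + 1) * (2 * k + m).factorial / (k.factorial * (k + m + 1).factorial) := by
  have h := Nat.add_choose_mul_factorial_mul_factorial (k + m + 1) k
  rw [mul_right_comm, show k + m + 1 + k = 2 * k + m + 1 by ring, Nat.factorial_succ (2 * k + m)] at h
  have h' : ((2 * k + m + 1).choose k : ℚ) * k.factorial * (k + m + 1).factorial =
      (2 * k + m + 1) * (2 * k + m).factorial := by exact_mod_cast h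
  have h1 : (k.factorial : ℚ) ≠ 0 := by positivity
  have h2 : ((k + m + 1).factorial : ℚ) ≠ 0 := by positivity
  have h3 : 2 * (k : ℚ) + m + 1 ≠ 0 := by positivity
  rw [ballot]
  field_simp
  linear_combination h'

theorem ballot_succ_zero (k : ℕ) : ballot (k + 1) 0 = ballot k 1 := by
  rw [ballot_eq, ballot_eq, show 2 * (k + 1) + 0 = 2 * k + 1 + 1 by ring,
    show k + 1 + 0 + 1 = k + 1 + 1 by ring, Nat.factorial_succ (2 * k + 1), Nat.factorial_succ k]
  have h1 : (k.factorial : ℚ) ≠ 0 := by positivity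
  have h2 : ((k + 1 + 1).factorial : ℚ) ≠ 0 := by positivity
  push_cast
  field_simp
  ring

theorem ballot_succ_succ (k m : ℕ) :
    ballot (k + 1) (m + 1) = ballot (k + 1) m + ballot k (m + 2) := by
  rw [ballot_eq, ballot_eq, ballot_eq, show 2 * (k + 1) + (m + 1) = 2 * k + m + 2 + 1 by ring,
    show 2 * (k + 1) + m = 2 * k + m + 2 by ring, show 2 * k + (m + 2) = 2 * k + m + 2 by ring,
    show k + 1 + (m + 1) + 1 = k + m + 2 + 1 by ring, show k + 1 + m + 1 = k + m + 2 by ring,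
    show k + (m + 2) + 1 = k + m + 2 + 1 by ring, Nat.factorial_succ (2 * k + m + 2),
    Nat.factorial_succ k, Nat.factorial_succ (k + m + 2)]
  have h1 : (k.factorial : ℚ) ≠ 0 := by positivity
  have h2 : ((k + m + 2).factorial : ℚ) ≠ 0 := by positivity
  push_cast
  field_simp
  ring

/-- The identity C^(m+1) = C^m + xC^(m+2) is the ballot recursion, used by induction on k and,
within it, on m. For m = 0 the term C^0 contributes nothing in positive degree, which matches
`ballot_succ_zero`. -/
theorem coeff_catalanGF_pow (k m : ℕ) :
    PowerSeries.coeff k (catalanGF ^ (m + 1)) = ballot k m := by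
  have h0 : PowerSeries.constantCoeff catalanGF = 1 := by
    rw [catalanGF_eq]; simp
  induction k generalizing m with
  | zero => simp [ballot_zero, h0]
  | succ k ih =>
    have hstep (m : ℕ) : catalanGF ^ (m + 1) =
        catalanGF ^ m + PowerSeries.X * catalanGF ^ (m + 2) := by
      linear_combination catalanGF ^ m * catalanGF_eq
    induction m with
    | zero =>
      rw [hstep, map_add, PowerSeries.coeff_succ_X_mul, ih, pow_zero, PowerSeries.coeff_one,
        if_neg (by omega), zero_add, ballot_succ_zero]
    | succ m ihm =>
      rw [hstep, map_add, PowerSeries.coeff_succ_X_mul, ih, ihm, ballot_succ_succ]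

/-- The term of index d in C(xC) contributes C_d times the coefficient of x^(n+1-d) in C^d. The term
d = 0 vanishes, and k = n + 1 - d reverses the sum. -/
theorem coeff_catalanComp (n : ℕ) :
    PowerSeries.coeff (n + 1) catalanComp =
      ∑ k ∈ Finset.range (n + 1), (catalan (n + 1 - k) : ℚ) * ballot k (n - k) := by
  have hc (d : ℕ) : PowerSeries.coeff d catalanGF = (catalan d : ℚ) := by
    simp [catalanGF]
  have hsupp : (Function.support fun d : ℕ => PowerSeries.coeff d catalanGF •
      PowerSeries.coeff (n + 1) ((PowerSeries.X * catalanGF) ^ d)) ⊆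
      ↑(Finset.range (n + 2)) := by
    intro d hd
    by_contra hlt
    simp only [Finset.coe_range, Set.mem_Iio, not_lt] at hlt
    refine hd ?_
    simp only
    rw [mul_pow, PowerSeries.coeff_X_pow_mul', if_neg (by omega), smul_zero]
  rw [catalanComp, PowerSeries.coeff_subst' hasSubst_X_mul_catalanGF,
    finsum_eq_sum_of_support_subset _ hsupp, Finset.sum_range_succ', pow_zero,
    PowerSeries.coeff_one, if_neg (by omega), smul_zero, add_zero, ← Finset.sum_range_reflect]
  refine Finset.sum_congr rfl fun k hk => ?_
  rw [Finset.mem_range] at hk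
  rw [show n + 1 - 1 - k + 1 = n + 1 - k by omega, mul_pow, PowerSeries.coeff_X_pow_mul',
    if_pos (by omega), show n + 1 - (n + 1 - k) = k by omega,
    show n + 1 - k = n - k + 1 by omega, coeff_catalanGF_pow, hc, smul_eq_mul]

theorem numIndecAvoiders_succ (n : ℕ) :
    (numIndecAvoiders (n + 1) : ℚ) = PowerSeries.coeff n catalanComp := by
  have h := congrArg (PowerSeries.coeff (n + 1)) indecAvoiderSeries_eq
  rw [xCxC_eq, PowerSeries.coeff_succ_X_mul] at h
  rw [← h, indecAvoiderSeries, PowerSeries.coeff_mk]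

theorem numIndecAvoiders_one : numIndecAvoiders 1 = 1 := by
  have h := numIndecAvoiders_succ 0
  rw [catalanComp_eq] at h
  simpa using h

end PermPattern
theorem mainTheorem1 :
    PermPattern.avoiderSeries = (1 - PermPattern.xCxC)⁻¹ ∧
    IsAlgebraic (Polynomial ℚ) PermPattern.avoiderSeries ∧
    PermPattern.indecAvoiderSeries = PermPattern.xCxC ∧
    PermPattern.avoiderSeries = (1 - PermPattern.indecAvoiderSeries)⁻¹ ∧
    PermPattern.numIndecAvoiders 0 = 0 ∧
    PermPattern.numIndecAvoiders 1 = 1 ∧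
    ∀ n : ℕ, 2 ≤ n →
      (PermPattern.numIndecAvoiders n : ℚ) =
        ∑ k ∈ Finset.range (n - 1),
          (catalan (n - 1 - k) : ℚ) * PermPattern.ballot k (n - 2 - k) ∧
      (PermPattern.numIndecAvoiders n : ℚ) =
        ∑ k ∈ Finset.range (n - 1),
          ((n : ℚ) - 1 - (k : ℚ)) / ((n : ℚ) - 1 + (k : ℚ)) * ((n - 1 + k).choose k : ℚ) *
            (catalan (n - 1 - k) : ℚ) := by
  refine ⟨PermPattern.avoiderSeries_eq, PermPattern.isAlgebraic_avoiderSeries,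
    PermPattern.indecAvoiderSeries_eq, ?_, PermPattern.numIndecAvoiders_zero,
    PermPattern.numIndecAvoiders_one, fun n hn => ?_⟩
  · rw [PermPattern.indecAvoiderSeries_eq]
    exact PermPattern.avoiderSeries_eq
  · obtain ⟨n, rfl⟩ := Nat.exists_eq_add_of_le' hn
    have h := PermPattern.coeff_catalanComp n
    rw [← PermPattern.numIndecAvoiders_succ] at h
    refine ⟨h, h.trans (Finset.sum_congr rfl fun k hk => ?_)⟩
    rw [Finset.mem_range] at hk
    rw [mul_comm, PermPattern.ballot, Nat.cast_sub (by omega),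
      show 2 * k + (n - k) + 1 = n + 2 - 1 + k by omega]
    push_cast
    congr 3 <;> ring
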